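/- Let $\mathcal T$ be the infinite rooted binary tree, and attach to its vertices two kinds of triples. The Markov tree has $(1,5,2)$ at the root, and below a vertex with triple $(x,y,z)$ the left child has $(x,\,3xy-z,\,y)$ and the right child has $(y,\,3yz-x,\,z)$. The Farey tree has $\left(\frac01,\frac12,\frac11\right)$ at the root, and below a vertex with triple $\left(\frac ab,\frac{a+c}{b+d},\frac cd\right)$ the left child has $\left(\frac ab,\frac{a+(a+c)}{b+(b+d)},\frac{a+c}{b+d}\right)$ and the right child has $\left(\frac{a+c}{b+d},\frac{(a+c)+c}{(b+d)+d},\frac cd\right)$. Every rational number strictly between $0$ and $1$ is the middle entry of the Farey triple at exactly one vertex. For coprime positive integers $p<q$, let the Markov number $m_{p/q}$ be the middle entry of the Markov triple at the vertex whose Farey triple has middle entry $\frac pq$ (so $m_{1/2}=5$, $m_{1/3}=13$, $m_{2/3}=29$). **Theorem 1.1.** Let $p,q,i$ be positive integers. 1. (Fixed Numerator Conjecture) If $p<q$, $\gcd(q,p)=1$ and $\gcd(q+i,p)=1$, then $m_{p/q}<m_{p/(q+i)}$. 2. (Fixed Denominator Conjecture) If $p+i<q$, $\gcd(q,p)=1$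 and $\gcd(q,p+i)=1$, then $m_{p/q}<m_{(p+i)/q}$. -/

import Mathlib

namespace MarkovOrder

/-- The vertices of the infinite rooted binary tree. -/
inductive Vertex : Type
  | root : Vertex
  | left : Vertex → Vertex
  | right : Vertex → Vertex

/-- An ordered triple. -/
@[ext]
structure Triple (α : Type) where
  fst : α
  mid : α
  lst : α

/-- The Markov tree: the root carries `(1, 5, 2)`; below a vertex carrying `(x, y, z)` the left
child carries `(x, 3xy - z, y)` and the right child carries `(y, 3yz - x, z)`. -/
def markovTree : Vertex → Triple ℤ
  | .root => ⟨1, 5, 2⟩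
  | .left v =>
      ⟨(markovTree v).fst, 3 * (markovTree v).fst * (markovTree v).mid - (markovTree v).lst,
        (markovTree v).mid⟩
  | .right v =>
      ⟨(markovTree v).mid, 3 * (markovTree v).mid * (markovTree v).lst - (markovTree v).fst,
        (markovTree v).lst⟩

/-- The mediant of `a/b` and `c/d` is `(a+c)/(b+d)`; a fraction `a/b` is stored as the pair
`(a, b)`. -/
def mediant (r s : ℕ × ℕ) : ℕ × ℕ := (r.1 + s.1, r.2 + s.2)

/-- The Farey tree: the root carries `(0/1, 1/2, 1/1)`; below a vertex carrying `(r, s, t)` the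
left child carries `(r, mediant r s, s)` and the right child carries `(s, mediant s t, t)`. -/
def fareyTree : Vertex → Triple (ℕ × ℕ)
  | .root => ⟨(0, 1), (1, 2), (1, 1)⟩
  | .left v =>
      ⟨(fareyTree v).fst, mediant (fareyTree v).fst (fareyTree v).mid, (fareyTree v).mid⟩
  | .right v =>
      ⟨(fareyTree v).mid, mediant (fareyTree v).mid (fareyTree v).lst, (fareyTree v).lst⟩

/-- The rational number in the middle of the Farey triple at a vertex. -/
def fareyMid (v : Vertex) : ℚ := ((fareyTree v).mid.1 : ℚ) / ((fareyTree v).mid.2 : ℚ)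

theorem fareyTree_mid (v : Vertex) :
    (fareyTree v).mid = mediant (fareyTree v).fst (fareyTree v).lst := by
  cases v <;> simp [fareyTree, mediant]

theorem fareyTree_inv (v : Vertex) :
    0 < (fareyTree v).fst.2 ∧ 0 < (fareyTree v).lst.2 ∧
    (fareyTree v).lst.1 * (fareyTree v).fst.2 =
      (fareyTree v).fst.1 * (fareyTree v).lst.2 + 1 := by
  induction v with
  | root => simp [fareyTree]
  | left v ih =>
    have hm := fareyTree_mid v
    simp only [fareyTree, hm, mediant]
    obtain ⟨h1, h2, h3⟩ := ih
    exact ⟨h1, by omega, by nlinarith⟩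
  | right v ih =>
    have hm := fareyTree_mid v
    simp only [fareyTree, hm, mediant]
    obtain ⟨h1, h2, h3⟩ := ih
    exact ⟨by omega, h2, by nlinarith⟩

theorem exists_vertex_aux (N : ℕ) : ∀ (v : Vertex) (m n : ℕ), m + n ≤ N → 0 < m → 0 < n →
    ∃ w, fareyMid w =
      ((m * (fareyTree v).fst.1 + n * (fareyTree v).lst.1 : ℕ) : ℚ) /
        ((m * (fareyTree v).fst.2 + n * (fareyTree v).lst.2 : ℕ) : ℚ) := by
  induction N with
  | zero => intro v m n h hm; omega
  | succ N ih =>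
    intro v m n h hm hn
    have hmid := fareyTree_mid v
    rcases lt_trichotomy m n with hlt | heq | hgt
    · obtain ⟨k, rfl⟩ := Nat.exists_eq_add_of_lt hlt
      obtain ⟨w, hw⟩ := ih (.right v) m (k + 1) (by omega) hm (by omega)
      refine ⟨w, hw.trans ?_⟩
      simp only [fareyTree, hmid, mediant]
      congr 2 <;> ring
    · subst heq
      refine ⟨v, ?_⟩
      have h0 : (m : ℚ) ≠ 0 := by exact_mod_cast hm.ne'
      simp only [fareyMid, hmid, mediant, ← mul_add]
      push_cast
      rw [mul_div_mul_left _ _ h0]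
    · obtain ⟨k, rfl⟩ := Nat.exists_eq_add_of_lt hgt
      obtain ⟨w, hw⟩ := ih (.left v) (k + 1) n (by omega) (by omega) hn
      refine ⟨w, hw.trans ?_⟩
      simp only [fareyTree, hmid, mediant]
      congr 2 <;> ring

/-- Every rational number strictly between 0 and 1 occurs in the middle of a Farey triple. -/
theorem exists_vertex (r : ℚ) (h0 : 0 < r) (h1 : r < 1) : ∃ v, fareyMid v = r := by
  have hn : 0 < r.num := Rat.num_pos.mpr h0
  have hlt : r.num < r.den := Rat.num_lt_denom_iff.mpr h1
  obtain ⟨n, hn'⟩ := Int.eq_ofNat_of_zero_le hn.le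
  have hr : (n : ℚ) / r.den = r := by
    have := Rat.num_div_den r
    rwa [hn', Int.cast_natCast] at this
  obtain ⟨w, hw⟩ := exists_vertex_aux _ .root (r.den - n) n le_rfl (by omega) (by omega)
  refine ⟨w, hw.trans ?_⟩
  have e : (r.den - n) * 1 + n * 1 = r.den := by omega
  simp only [fareyTree, e]
  simpa using hr

theorem fareyTree_injective : Function.Injective fareyTree := by
  intro v
  induction v with
  | root =>
    intro w h
    cases w with
    | root => rfl
    | left w =>
      have := fareyTree_inv w
      have hm := fareyTree_mid w
      simp only [fareyTree, hm, mediant, Triple.mk.injEq, Prod.ext_iff] at h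
      omega
    | right w =>
      have := fareyTree_inv w
      have hm := fareyTree_mid w
      simp only [fareyTree, hm, mediant, Triple.mk.injEq, Prod.ext_iff] at h
      omega
  | left v ih =>
    intro w h
    have hv := fareyTree_inv v
    have hmv := fareyTree_mid v
    cases w with
    | root =>
      simp only [fareyTree, hmv, mediant, Triple.mk.injEq, Prod.ext_iff] at h
      omega
    | left w =>
      have hmw := fareyTree_mid w
      rw [ih (a₂ := w)]
      simp only [fareyTree, hmv, hmw, mediant, Triple.mk.injEq, Prod.ext_iff] at h
      ext <;> (try simp only [hmv, hmw, mediant]) <;> omega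
    | right w =>
      have hw := fareyTree_inv w
      have hmw := fareyTree_mid w
      simp only [fareyTree, hmv, hmw, mediant, Triple.mk.injEq, Prod.ext_iff] at h
      omega
  | right v ih =>
    intro w h
    have hv := fareyTree_inv v
    have hmv := fareyTree_mid v
    cases w with
    | root =>
      simp only [fareyTree, hmv, mediant, Triple.mk.injEq, Prod.ext_iff] at h
      omega
    | left w =>
      have hw := fareyTree_inv w
      have hmw := fareyTree_mid w
      simp only [fareyTree, hmv, hmw, mediant, Triple.mk.injEq, Prod.ext_iff] at h
      omega
    | right w =>
      have hmw := fareyTree_mid w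
      rw [ih (a₂ := w)]
      simp only [fareyTree, hmv, hmw, mediant, Triple.mk.injEq, Prod.ext_iff] at h
      ext <;> (try simp only [hmv, hmw, mediant]) <;> omega

theorem fareyTree_mid_coprime (v : Vertex) :
    Nat.Coprime (fareyTree v).mid.1 (fareyTree v).mid.2 := by
  obtain ⟨-, -, h⟩ := fareyTree_inv v
  rw [fareyTree_mid v, ← Nat.isCoprime_iff_coprime]
  refine ⟨(fareyTree v).fst.2, -(fareyTree v).fst.1, ?_⟩
  simp only [mediant]
  push_cast
  zify at h
  linear_combination h

/-- A rational number occurs in the middle of at most one Farey triple. -/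
theorem fareyMid_injective : Function.Injective fareyMid := by
  intro v w h
  have hv := fareyTree_inv v
  have hw := fareyTree_inv w
  have hmv := fareyTree_mid v
  have hmw := fareyTree_mid w
  have cv := fareyTree_mid_coprime v
  have cw := fareyTree_mid_coprime w
  have pv : 0 < (fareyTree v).mid.2 := by rw [hmv]; simp only [mediant]; omega
  have pw : 0 < (fareyTree w).mid.2 := by rw [hmw]; simp only [mediant]; omega
  have hmid : (fareyTree v).mid = (fareyTree w).mid := by
    have h' := (Rat.div_int_inj (a := (fareyTree v).mid.1) (b := (fareyTree v).mid.2)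
      (c := (fareyTree w).mid.1) (d := (fareyTree w).mid.2)
      (by exact_mod_cast pv) (by exact_mod_cast pw) (by simpa using cv) (by simpa using cw)
      (by simpa [fareyMid] using h))
    exact Prod.ext (by exact_mod_cast h'.1) (by exact_mod_cast h'.2)
  apply fareyTree_injective
  generalize fareyTree v = s at *
  generalize fareyTree w = t at *
  obtain ⟨⟨a, b⟩, ⟨p, q⟩, ⟨c, d⟩⟩ := s
  obtain ⟨⟨a', b'⟩, ⟨p', q'⟩, ⟨c', d'⟩⟩ := t
  simp only [mediant, Prod.mk.injEq] at *
  obtain ⟨rfl, rfl⟩ := hmid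
  obtain ⟨e1, e2⟩ := hmv
  obtain ⟨e3, e4⟩ := hmw
  obtain ⟨hb, hd, hdet⟩ := hv
  obtain ⟨hb', hd', hdet'⟩ := hw
  have k : (p : ℤ) * b - a * q = 1 := by
    subst e1 e2; push_cast; zify at hdet; linear_combination hdet
  have k' : (p : ℤ) * b' - a' * q = 1 := by
    rw [e3, e4]; push_cast; zify at hdet'; linear_combination hdet'
  have hdvd : (q : ℤ) ∣ (b : ℤ) - b' := by
    apply IsCoprime.dvd_of_dvd_mul_left (Nat.isCoprime_iff_coprime.mpr cv.symm)
    exact ⟨a - a', by linear_combination k - k'⟩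
  have hbb : (b : ℤ) - b' = 0 :=
    Int.eq_zero_of_abs_lt_dvd hdvd (by rw [abs_lt]; constructor <;> omega)
  have hb2 : b = b' := by omega
  subst hb2
  have ha : (a : ℤ) = a' :=
    mul_right_cancel₀ (b := (q : ℤ)) (by exact_mod_cast pv.ne') (by linear_combination k' - k)
  have ha2 : a = a' := by exact_mod_cast ha
  subst ha2
  have : c = c' := by omega
  have : d = d' := by omega
  simp [*]

open Classical in
/-- The Markov number `m_r` indexed by a rational number `r ∈ [0,1]`: `m_0 = 1`, `m_1 = 2`, and
for `0 < r < 1` it is the middle entry of the Markov triple located at the vertex where `r` is the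
middle entry of the Farey triple (that vertex exists and is unique).
Outside `[0,1]` the value is the irrelevant `0`. -/
noncomputable def markovNumber (r : ℚ) : ℤ :=
  if r = 0 then 1
  else if r = 1 then 2
  else if h : ∃ v, fareyMid v = r then (markovTree h.choose).mid
  else 0

/-- The defining property of `m_r` for `0 < r < 1`. -/
theorem markovNumber_fareyMid (v : Vertex) :
    markovNumber (fareyMid v) = (markovTree v).mid := by
  have h : ∃ w, fareyMid w = fareyMid v := ⟨v, rfl⟩
  obtain ⟨hb, hd, hdet⟩ := fareyTree_inv v
  have hm := fareyTree_mid v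
  have hc : 0 < (fareyTree v).lst.1 := by
    rcases Nat.eq_zero_or_pos (fareyTree v).lst.1 with h0 | h0
    · rw [h0] at hdet; omega
    · exact h0
  have hcop := fareyTree_mid_coprime v
  have h0 : fareyMid v ≠ 0 := by
    have h1 : (0 : ℚ) < (fareyTree v).mid.1 := by
      rw [hm]; simp only [mediant]; exact_mod_cast (by omega)
    have h2 : (0 : ℚ) < (fareyTree v).mid.2 := by
      rw [hm]; simp only [mediant]; exact_mod_cast (by omega)
    exact (div_pos h1 h2).ne'
  have h1 : fareyMid v ≠ 1 := by
    intro e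
    have h2 : ((fareyTree v).mid.2 : ℚ) ≠ 0 := by
      rw [hm]; simp only [mediant]; exact_mod_cast (by omega)
    rw [fareyMid, div_eq_one_iff_eq h2] at e
    have e' : (fareyTree v).mid.1 = (fareyTree v).mid.2 := by exact_mod_cast e
    rw [e', Nat.coprime_self, hm] at hcop
    simp only [mediant] at hcop
    omega
  rw [markovNumber, if_neg h0, if_neg h1, dif_pos h]
  rw [fareyMid_injective h.choose_spec]

end MarkovOrder

/-!
Write `2 cosh L = 3 m` for a Markov number `m`, so that along a branch of the Markov tree the
numbers `2 cosh L` obey the trace recursion `t (u + v) + t (u - v) = t u * t v`; geometrically `L`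
is (half) the length of a simple closed geodesic on the modular torus, viewed as a function of its
homology class `u ∈ ℤ²`, and the point is that `L` behaves like a norm on `ℤ²`.

Let `ω` be one of the two coordinates of the Farey vectors (numerator or denominator). Both
conjectures say that, on the vectors with a fixed value of `ω`, the length `L` is monotone in the
slope, and this follows once `ω / L` is strictly monotone in the slope over all Farey fractions.
In a Farey triple `(u, u + v, v)`, with `L` taking the values `α, γ, β` and `ω` the values
`a, a + c, c`, the monotonicity `a / α < (a + c) / γ < c / β` rests on two estimates.

* Subadditivity `γ < α + β`, which together with `a / α < c / β` gives the left inequality.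
* A bound on the asymptotic slope of `L` at `v`: the trace of `u + k v` is
  `A exp (k β) + B exp (-k β)`, where `A * B > 1` by the Markov equation, and the invariant is
  `A ≥ exp ((a / c) β)`. It gives the right inequality (`SlopeInvariant.add_mul_lt`), is trivially
  preserved for the pair `(u + v, v)` (`SlopeInvariant.right`), and is preserved for the pair
  `(u, u + v)` because of that same right inequality (`SlopeInvariant.left`).

Numerators are treated on the Farey tree itself, denominators on its mirror image. The passage from
the three entries of each triple to all vertices is the in-order traversal of the binary tree
(`InOrder.mid_lt_mid`).
-/

namespace MarkovOrder

/-! ### In-order labellings of the binary tree -/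

/-- `Below d w` says that `w` is the vertex `d` or one of its descendants. -/
inductive Below (d : Vertex) : Vertex → Prop
  | refl : Below d d
  | left {w : Vertex} : Below d w → Below d (.left w)
  | right {w : Vertex} : Below d w → Below d (.right w)

/-- `Prec v w` says that `v` comes strictly before `w` in the in-order traversal: their last common
ancestor `e` separates them, one of them being possibly `e` itself. -/
def Prec (v w : Vertex) : Prop :=
  ∃ e, (Below (.left e) v ∧ w = e) ∨ (v = e ∧ Below (.right e) w) ∨
    (Below (.left e) v ∧ Below (.right e) w)

theorem Below.eq_or {d w : Vertex} (h : Below d w) :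
    w = d ∨ Below (.left d) w ∨ Below (.right d) w := by
  induction h with
  | refl => exact .inl rfl
  | left _ ih =>
    rcases ih with rfl | h | h
    · exact .inr (.inl .refl)
    · exact .inr (.inl h.left)
    · exact .inr (.inr h.left)
  | right _ ih =>
    rcases ih with rfl | h | h
    · exact .inr (.inr .refl)
    · exact .inr (.inl h.right)
    · exact .inr (.inr h.right)

theorem below_root (d : Vertex) : Below .root d := by
  induction d with
  | root => exact .refl
  | left _ ih => exact ih.left
  | right _ ih => exact ih.right

theorem below_or_separated (w d : Vertex) :
    Below w d ∨ Below d w ∨ ∃ e, (Below (.left e) d ∧ Below (.right e) w) ∨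
      (Below (.left e) w ∧ Below (.right e) d) := by
  induction w with
  | root => exact .inl (below_root d)
  | left w ih =>
    rcases ih with h | h | ⟨e, h | h⟩
    · rcases h.eq_or with rfl | h | h
      · exact .inr (.inl (.left .refl))
      · exact .inl h
      · exact .inr (.inr ⟨w, .inr ⟨.refl, h⟩⟩)
    · exact .inr (.inl h.left)
    · exact .inr (.inr ⟨e, .inl ⟨h.1, h.2.left⟩⟩)
    · exact .inr (.inr ⟨e, .inr ⟨h.1.left, h.2⟩⟩)
  | right w ih =>
    rcases ih with h | h | ⟨e, h | h⟩
    · rcases h.eq_or with rfl | h | h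
      · exact .inr (.inl (.right .refl))
      · exact .inr (.inr ⟨w, .inl ⟨h, .refl⟩⟩)
      · exact .inl h
    · exact .inr (.inl h.right)
    · exact .inr (.inr ⟨e, .inl ⟨h.1, h.2.right⟩⟩)
    · exact .inr (.inr ⟨e, .inr ⟨h.1.right, h.2⟩⟩)

theorem eq_or_prec (v w : Vertex) : v = w ∨ Prec v w ∨ Prec w v := by
  rcases below_or_separated v w with h | h | ⟨e, h | h⟩
  · rcases h.eq_or with h | h | h
    · exact .inl h.symm
    · exact .inr (.inr ⟨v, .inl ⟨h, rfl⟩⟩)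
    · exact .inr (.inl ⟨v, .inr (.inl ⟨rfl, h⟩)⟩)
  · rcases h.eq_or with h | h | h
    · exact .inl h
    · exact .inr (.inl ⟨w, .inl ⟨h, rfl⟩⟩)
    · exact .inr (.inr ⟨w, .inr (.inl ⟨rfl, h⟩)⟩)
  · exact .inr (.inr ⟨e, .inr (.inr h)⟩)
  · exact .inr (.inl ⟨e, .inr (.inr h)⟩)

/-- A labelling of the vertices by triples is in-order if the label of a child reuses the entries
of its parent as in the Farey tree and the entries of each triple increase strictly. -/
structure InOrder {α : Type} [Preorder α] (g : Vertex → Triple α) : Prop where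
  left_fst : ∀ v, (g (.left v)).fst = (g v).fst
  left_lst : ∀ v, (g (.left v)).lst = (g v).mid
  right_fst : ∀ v, (g (.right v)).fst = (g v).mid
  right_lst : ∀ v, (g (.right v)).lst = (g v).lst
  fst_lt : ∀ v, (g v).fst < (g v).mid
  mid_lt : ∀ v, (g v).mid < (g v).lst

namespace InOrder

variable {α β : Type} [Preorder α] [Preorder β] {f : Vertex → Triple α} {g : Vertex → Triple β}

theorem fst_le_of_below (hg : InOrder g) {d w : Vertex} (h : Below d w) :
    (g d).fst ≤ (g w).fst ∧ (g w).lst ≤ (g d).lst := by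
  induction h with
  | refl => exact ⟨le_rfl, le_rfl⟩
  | @left w _ ih =>
    rw [hg.left_fst, hg.left_lst]
    exact ⟨ih.1, (hg.mid_lt w).le.trans ih.2⟩
  | @right w _ ih =>
    rw [hg.right_fst, hg.right_lst]
    exact ⟨ih.1.trans (hg.fst_lt w).le, ih.2⟩

theorem lt_of_below_left (hg : InOrder g) {e w : Vertex} (h : Below (.left e) w) :
    (g w).mid < (g e).mid :=
  (hg.mid_lt w).trans_le ((hg.fst_le_of_below h).2.trans_eq (hg.left_lst e))

theorem lt_of_below_right (hg : InOrder g) {e w : Vertex} (h : Below (.right e) w) :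
    (g e).mid < (g w).mid :=
  (hg.right_fst e).symm.trans_le (hg.fst_le_of_below h).1 |>.trans_lt (hg.fst_lt w)

theorem lt_of_prec (hg : InOrder g) {v w : Vertex} (h : Prec v w) : (g v).mid < (g w).mid := by
  obtain ⟨e, ⟨h, rfl⟩ | ⟨rfl, h⟩ | ⟨h, h'⟩⟩ := h
  · exact hg.lt_of_below_left h
  · exact hg.lt_of_below_right h
  · exact (hg.lt_of_below_left h).trans (hg.lt_of_below_right h')

/-- Any two in-order labellings order the vertices in the same way. -/
theorem mid_lt_mid (hf : InOrder f) (hg : InOrder g) {v w : Vertex}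
    (h : (f v).mid < (f w).mid) : (g v).mid < (g w).mid := by
  rcases eq_or_prec v w with rfl | h' | h'
  · exact absurd h (lt_irrefl _)
  · exact hg.lt_of_prec h'
  · exact absurd (hf.lt_of_prec h') h.not_gt

end InOrder

/-- The Farey tree, with its entries read as rational numbers. -/
def fareyRat (v : Vertex) : Triple ℚ :=
  ⟨(fareyTree v).fst.1 / (fareyTree v).fst.2, fareyMid v,
    (fareyTree v).lst.1 / (fareyTree v).lst.2⟩

theorem inOrder_fareyRat : InOrder fareyRat where
  left_fst _ := rfl
  left_lst _ := rfl
  right_fst _ := rfl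
  right_lst _ := rfl
  fst_lt v := by
    obtain ⟨hb, hd, h⟩ := fareyTree_inv v
    simp only [fareyRat, fareyMid, fareyTree_mid v, mediant]
    rw [div_lt_div_iff₀ (by exact_mod_cast hb) (by exact_mod_cast (by omega))]
    norm_cast
    nlinarith
  mid_lt v := by
    obtain ⟨hb, hd, h⟩ := fareyTree_inv v
    simp only [fareyRat, fareyMid, fareyTree_mid v, mediant]
    rw [div_lt_div_iff₀ (by exact_mod_cast (by omega)) (by exact_mod_cast hd)]
    norm_cast
    nlinarith

/-! ### Hyperbolic estimates -/

theorem two_cosh_lt_add {e U V : ℝ} (he : 0 ≤ e) (hU : Real.exp e ≤ U) (hUV : 1 < U * V) :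
    2 * Real.cosh e < U + V := by
  have h1 : 1 ≤ Real.exp e := Real.one_le_exp he
  have h2 : Real.exp e * Real.exp (-e) = 1 := by rw [← Real.exp_add]; simp
  rw [Real.cosh_eq]
  set E := Real.exp e
  set F := Real.exp (-e)
  have hU0 : 0 < U := by linarith
  have hF0 : F ≤ 1 := by nlinarith [Real.exp_pos (-e)]
  have : 0 < U * (U + V - (E + F)) := by nlinarith
  nlinarith [pos_of_mul_pos_right this hU0.le]

theorem lt_of_two_cosh_lt {e g : ℝ} (hg : 0 ≤ g) (h : 2 * Real.cosh e < 2 * Real.cosh g) :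
    e < g := by
  have h' : |e| < |g| := Real.cosh_lt_cosh.mp (by linarith)
  exact (le_abs_self e).trans_lt (h'.trans_eq (abs_of_nonneg hg))

theorem exp_mul_exp_neg (x : ℝ) : Real.exp x * Real.exp (-x) = 1 := by
  rw [← Real.exp_add]; simp

theorem two_cosh_eq (x : ℝ) : 2 * Real.cosh x = Real.exp x + Real.exp (-x) := by
  rw [Real.cosh_eq]; ring

/-- The invariant of a Farey pair `(u, v)` of weights `a, c`, where the traces of `u`, `u + v`, `v`
are `2 cosh α`, `2 cosh γ`, `2 cosh β`.

The field `le_mul_two` says that the trace of `u + v` is the larger of the two roots of the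
Markov equation. In `slope`, dividing by `2 sinh β` turns the left-hand side into the coefficient
`A` of the expansion `A exp (k β) + B exp (-k β)` of the trace of `u + k v`. -/
structure SlopeInvariant (a c α γ β : ℝ) : Prop where
  weight_nonneg : 0 ≤ a
  weight_pos : 0 < c
  α_pos : 0 < α
  γ_pos : 0 < γ
  β_pos : 0 < β
  markov : (2 * Real.cosh α) ^ 2 + (2 * Real.cosh γ) ^ 2 + (2 * Real.cosh β) ^ 2 =
    2 * Real.cosh α * (2 * Real.cosh γ) * (2 * Real.cosh β)
  le_mul_two : 2 * Real.cosh α * (2 * Real.cosh β) ≤ 2 * (2 * Real.cosh γ)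
  slope : (Real.exp β - Real.exp (-β)) * Real.exp (a / c * β) ≤
    2 * Real.cosh γ - 2 * Real.cosh α * Real.exp (-β)
  mul_lt : a * β < c * α

namespace SlopeInvariant

variable {a c α γ β : ℝ}

theorem add_mul_lt (h : SlopeInvariant a c α γ β) : (a + c) * β < c * γ := by
  obtain ⟨ha, hc, hα, hγ, hβ, hM, -, hI, -⟩ := h
  have hs : 0 ≤ a / c := by positivity
  have hPQ := exp_mul_exp_neg β
  have hZ := two_cosh_eq β
  have hexp : Real.exp (β + a / c * β) = Real.exp β * Real.exp (a / c * β) := Real.exp_add _ _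
  have hδ : 0 < Real.exp β - Real.exp (-β) := by
    rw [sub_pos, Real.exp_lt_exp]; linarith
  have hP := Real.exp_pos β
  have hQ := Real.exp_pos (-β)
  have key : 2 * Real.cosh (β + a / c * β) < 2 * Real.cosh γ := by
    rw [hZ] at hM
    set P := Real.exp β
    set Q := Real.exp (-β)
    set X := 2 * Real.cosh α
    set Y := 2 * Real.cosh γ
    have hUV : 1 < (Y - X * Q) * P / (P - Q) * ((X * P - Y) * Q / (P - Q)) := by
      rw [div_mul_div_comm, one_lt_div (by positivity)]
      have : (Y - X * Q) * P * ((X * P - Y) * Q) = (P + Q) ^ 2 := by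
        linear_combination ((Y - X * Q) * (X * P - Y) - X ^ 2) * hPQ - hM
      rw [this]
      nlinarith
    have hU : Real.exp (β + a / c * β) ≤ (Y - X * Q) * P / (P - Q) := by
      rw [hexp, le_div_iff₀ hδ]
      nlinarith
    have h := two_cosh_lt_add (by positivity) hU hUV
    have hsum : (Y - X * Q) * P / (P - Q) + (X * P - Y) * Q / (P - Q) = Y := by
      field_simp
      ring
    linarith
  have := lt_of_two_cosh_lt hγ.le key
  calc (a + c) * β = c * (β + a / c * β) := by field_simp; ring
    _ < c * γ := by gcongr

/-- `2 cosh (α + β)` and `2 cosh (α - β)` have the same sum as the two roots of the Markov equation,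
but a larger difference. -/
theorem lt_add (h : SlopeInvariant a c α γ β) : γ < α + β := by
  obtain ⟨-, -, hα, hγ, hβ, hM, hle, -, -⟩ := h
  apply lt_of_two_cosh_lt (by positivity)
  rw [Real.cosh_add]
  have hx := Real.cosh_sq α
  have hz := Real.cosh_sq β
  have hsx : 0 < Real.sinh α := Real.sinh_pos_iff.mpr hα
  have hsz : 0 < Real.sinh β := Real.sinh_pos_iff.mpr hβ
  set x := Real.cosh α
  set y := Real.cosh γ
  set z := Real.cosh β
  set s := Real.sinh α
  set t := Real.sinh β
  have hst : 0 < s * t := by positivity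
  -- The Markov equation reads `(y - x z) ^ 2 = x ^ 2 z ^ 2 - x ^ 2 - z ^ 2 = (s t) ^ 2 - 1`.
  have h1 : (y - x * z) ^ 2 = (s * t) ^ 2 - 1 := by
    linear_combination hM / 4 + (z ^ 2 - 1) * hx + s ^ 2 * hz
  have h2 : |y - x * z| < s * t := abs_lt_of_sq_lt_sq (by linarith) hst.le
  linarith [(abs_lt.mp h2).2]

theorem mul_lt_add_mul (h : SlopeInvariant a c α γ β) : a * γ < (a + c) * α := by
  have h1 := h.lt_add
  have h2 := h.mul_lt
  have h3 := h.weight_nonneg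
  nlinarith

/-- In a triple of traces whose middle entry is the larger root of the Markov equation, the
product of the middle entry with a neighbour is at least twice the other outer entry. -/
theorem two_mul_le_mul {x y z : ℝ} (hx : 2 ≤ x) (hz : 0 ≤ z) (h : x * z ≤ 2 * y) :
    2 * z ≤ x * y := by
  have h1 : x * (x * z) ≤ x * (2 * y) := mul_le_mul_of_nonneg_left h (by linarith)
  have h2 : 4 * z ≤ x * x * z := mul_le_mul_of_nonneg_right (by nlinarith) hz
  linarith

theorem left {γ' : ℝ} (h : SlopeInvariant a c α γ β) (hγ' : 0 < γ')
    (e : 2 * Real.cosh γ' = 2 * Real.cosh α * (2 * Real.cosh γ) - 2 * Real.cosh β) :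
    SlopeInvariant a (a + c) α γ' γ := by
  have hK := h.add_mul_lt
  have hT := h.mul_lt_add_mul
  obtain ⟨ha, hc, hα, hγ, hβ, hM, hle, hI, hH⟩ := h
  have hcα := Real.one_le_cosh α
  have hcβ := Real.one_le_cosh β
  refine ⟨ha, by positivity, hα, hγ', hγ, ?_, ?_, ?_, hT⟩
  · rw [e]; linear_combination hM
  · rw [e]
    have := two_mul_le_mul (by linarith) (by linarith) hle
    linarith
  · have hPQ := exp_mul_exp_neg γ
    have hY := two_cosh_eq γ
    have hδ : 0 < Real.exp γ - Real.exp (-γ) := by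
      rw [sub_pos, Real.exp_lt_exp]; linarith
    have hP := Real.exp_pos γ
    have hQ := Real.exp_pos (-γ)
    rw [e, hY]
    rw [hY] at hM
    have hexp : Real.exp (γ - β) = Real.exp γ * Real.exp (-β) := by
      rw [sub_eq_add_neg, Real.exp_add]
    have hββ := exp_mul_exp_neg β
    have hPβ := Real.exp_pos (-β)
    have hs : Real.exp (a / (a + c) * γ) ≤ Real.exp (γ - β) := by
      rw [Real.exp_le_exp, ← sub_nonneg]
      have : γ - β - a / (a + c) * γ = (c * γ - (a + c) * β) / (a + c) := by
        field_simp; ring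
      rw [this]
      exact div_nonneg (by linarith) (by positivity)
    set P := Real.exp γ
    set Q := Real.exp (-γ)
    set X := 2 * Real.cosh α
    -- The trace of `u + k (u + v)` is `A P ^ k + B Q ^ k`.
    obtain ⟨A, hA⟩ : ∃ A, A = (X * P - 2 * Real.cosh β) / (P - Q) := ⟨_, rfl⟩
    obtain ⟨B, hB⟩ : ∃ B, B = (2 * Real.cosh β - X * Q) / (P - Q) := ⟨_, rfl⟩
    have hAB : 1 < A * B := by
      rw [hA, hB, div_mul_div_comm, one_lt_div (by positivity)]
      have : (X * P - 2 * Real.cosh β) * (2 * Real.cosh β - X * Q) = (P + Q) ^ 2 := by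
        linear_combination - hM - X ^ 2 * hPQ
      rw [this]
      linarith
    have hsum : A + B = X := by
      rw [hA, hB]; field_simp; ring
    have hsum' : A * Q + B * P = 2 * Real.cosh β := by
      rw [hA, hB]; field_simp; ring
    have hA0 : 0 < A := by
      by_contra! hneg
      have hB0 : B < 0 := by
        by_contra! hB0
        linarith [mul_nonpos_of_nonpos_of_nonneg hneg hB0]
      linarith
    have hB0 : 0 < B := (mul_pos_iff_of_pos_left hA0).mp (by linarith)
    have hBP : B * P < Real.exp β := by
      by_contra! hge
      have := two_cosh_lt_add (V := A * Q) hβ.le hge (by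
        calc (1 : ℝ) < A * B := hAB
          _ = B * P * (A * Q) := by linear_combination (-A * B) * hPQ)
      linarith
    have hAlow : Real.exp (γ - β) ≤ A := by
      rw [hexp]
      have h1 : B * P * Real.exp (-β) < Real.exp β * Real.exp (-β) :=
        mul_lt_mul_of_pos_right hBP hPβ
      by_contra! hlt
      have h2 : A * B < P * Real.exp (-β) * B := mul_lt_mul_of_pos_right hlt hB0
      linarith
    have hA' : X * P - 2 * Real.cosh β = A * (P - Q) := by
      rw [hA]; field_simp
    calc (P - Q) * Real.exp (a / (a + c) * γ) ≤ (P - Q) * A := by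
          gcongr; exact hs.trans hAlow
      _ = X * (P + Q) - 2 * Real.cosh β - X * Q := by linear_combination -hA'

theorem right {γ' : ℝ} (h : SlopeInvariant a c α γ β) (hγ' : 0 < γ')
    (e : 2 * Real.cosh γ' = 2 * Real.cosh γ * (2 * Real.cosh β) - 2 * Real.cosh α) :
    SlopeInvariant (a + c) c γ γ' β := by
  have hK := h.add_mul_lt
  obtain ⟨ha, hc, hα, hγ, hβ, hM, hle, hI, hH⟩ := h
  have hcα := Real.one_le_cosh α
  have hcβ := Real.one_le_cosh β
  refine ⟨by positivity, hc, hγ, hγ', hβ, ?_, ?_, ?_, hK⟩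
  · rw [e]; linear_combination hM
  · rw [e]
    have := two_mul_le_mul (x := 2 * Real.cosh β) (by linarith) (by linarith)
      ((mul_comm _ _).trans_le hle)
    linarith
  · have hexp : Real.exp ((a + c) / c * β) = Real.exp β * Real.exp (a / c * β) := by
      rw [← Real.exp_add]; congr 1; field_simp; ring
    have hPQ := exp_mul_exp_neg β
    have hZ := two_cosh_eq β
    rw [e, hexp, hZ]
    calc _ = Real.exp β * ((Real.exp β - Real.exp (-β)) * Real.exp (a / c * β)) := by ring
      _ ≤ Real.exp β * (2 * Real.cosh γ - 2 * Real.cosh α * Real.exp (-β)) := by gcongr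
      _ = _ := by linear_combination (-(2 * Real.cosh α)) * hPQ

theorem weight_div_lt (h : SlopeInvariant a c α γ β) : a / α < (a + c) / γ := by
  rw [div_lt_div_iff₀ h.α_pos h.γ_pos]
  exact h.mul_lt_add_mul

theorem weight_div_lt' (h : SlopeInvariant a c α γ β) : (a + c) / γ < c / β := by
  rw [div_lt_div_iff₀ h.γ_pos h.β_pos]
  exact h.add_mul_lt

end SlopeInvariant

/-! ### Lengths on the Markov tree -/

/-- The length `L` attached to a Markov number `n`, defined by `2 cosh L = 3 n`. -/
noncomputable def markovLength (n : ℤ) : ℝ := Real.arcosh (3 * n / 2)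

theorem two_cosh_markovLength {n : ℤ} (hn : 1 ≤ n) : 2 * Real.cosh (markovLength n) = 3 * n := by
  have : (1 : ℝ) ≤ n := by exact_mod_cast hn
  rw [markovLength, Real.cosh_arcosh (by linarith)]
  ring

theorem markovLength_pos {n : ℤ} (hn : 1 ≤ n) : 0 < markovLength n := by
  have : (1 : ℝ) ≤ n := by exact_mod_cast hn
  exact Real.arcosh_pos (by linarith)

theorem markovLength_lt_markovLength {m n : ℤ} (hm : 1 ≤ m) (hn : 1 ≤ n) :
    markovLength m < markovLength n ↔ m < n := by
  have hm' : (1 : ℝ) ≤ m := by exact_mod_cast hm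
  have hn' : (1 : ℝ) ≤ n := by exact_mod_cast hn
  rw [markovLength, markovLength, Real.arcosh_lt_arcosh (by linarith) (by linarith),
    ← Int.cast_lt (R := ℝ)]
  constructor <;> intro h <;> linarith

theorem markovTree_one_le (v : Vertex) :
    1 ≤ (markovTree v).fst ∧ 1 ≤ (markovTree v).lst ∧ (markovTree v).fst ≤ (markovTree v).mid ∧
      (markovTree v).lst ≤ (markovTree v).mid := by
  induction v with
  | root => simp [markovTree]
  | left v ih =>
    obtain ⟨h1, h2, h3, h4⟩ := ih
    refine ⟨h1, h1.trans h3, ?_, ?_⟩ <;> simp only [markovTree] <;> nlinarith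
  | right v ih =>
    obtain ⟨h1, h2, h3, h4⟩ := ih
    refine ⟨h2.trans h4, h2, ?_, ?_⟩ <;> simp only [markovTree] <;> nlinarith

theorem markovTree_one_le_mid (v : Vertex) : 1 ≤ (markovTree v).mid :=
  (markovTree_one_le v).1.trans (markovTree_one_le v).2.2.1

/-- The lengths of the three entries of the Markov triple at a vertex. -/
noncomputable def lengthTree (v : Vertex) : Triple ℝ :=
  ⟨markovLength (markovTree v).fst, markovLength (markovTree v).mid,
    markovLength (markovTree v).lst⟩

theorem two_cosh_left (v : Vertex) : 2 * Real.cosh (lengthTree (.left v)).mid =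
    2 * Real.cosh (lengthTree v).fst * (2 * Real.cosh (lengthTree v).mid) -
      2 * Real.cosh (lengthTree v).lst := by
  have h := markovTree_one_le v
  simp only [lengthTree]
  rw [two_cosh_markovLength (markovTree_one_le_mid _), two_cosh_markovLength h.1,
    two_cosh_markovLength (markovTree_one_le_mid _), two_cosh_markovLength h.2.1]
  simp only [markovTree]
  push_cast
  ring

theorem two_cosh_right (v : Vertex) : 2 * Real.cosh (lengthTree (.right v)).mid =
    2 * Real.cosh (lengthTree v).mid * (2 * Real.cosh (lengthTree v).lst) -
      2 * Real.cosh (lengthTree v).fst := by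
  have h := markovTree_one_le v
  simp only [lengthTree]
  rw [two_cosh_markovLength (markovTree_one_le_mid _), two_cosh_markovLength h.1,
    two_cosh_markovLength (markovTree_one_le_mid _), two_cosh_markovLength h.2.1]
  simp only [markovTree]
  push_cast
  ring

theorem lengthTree_mid_pos (v : Vertex) : 0 < (lengthTree v).mid :=
  markovLength_pos (markovTree_one_le_mid v)

theorem two_cosh_root : 2 * Real.cosh (lengthTree .root).fst = 3 ∧
    2 * Real.cosh (lengthTree .root).mid = 15 ∧ 2 * Real.cosh (lengthTree .root).lst = 6 := by
  simp only [lengthTree, markovTree]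
  rw [two_cosh_markovLength (by norm_num), two_cosh_markovLength (by norm_num),
    two_cosh_markovLength (by norm_num)]
  norm_num

theorem lengthTree_root_pos : 0 < (lengthTree .root).fst ∧ 0 < (lengthTree .root).lst :=
  ⟨markovLength_pos (by simp [markovTree]), markovLength_pos (by simp [markovTree])⟩

/-! ### The two weights -/

theorem slopeInvariant_num (v : Vertex) :
    SlopeInvariant (fareyTree v).fst.1 (fareyTree v).lst.1
      (lengthTree v).fst (lengthTree v).mid (lengthTree v).lst := by
  induction v with
  | root =>
    obtain ⟨hx, hy, hz⟩ := two_cosh_root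
    obtain ⟨p1, p2⟩ := lengthTree_root_pos
    have p3 := lengthTree_mid_pos .root
    refine ⟨by simp [fareyTree], by simp [fareyTree], p1, p3, p2, ?_, ?_, ?_, ?_⟩
    · rw [hx, hy, hz]; norm_num
    · rw [hx, hy, hz]; norm_num
    · rw [hx, hy]
      have h1 : Real.exp (-(lengthTree .root).lst) < 1 := by
        rw [Real.exp_lt_one_iff]; linarith
      have h2 := Real.exp_pos (-(lengthTree .root).lst)
      have h3 := two_cosh_eq (lengthTree .root).lst
      simp only [fareyTree, Nat.cast_zero, zero_div, zero_mul, Real.exp_zero]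
      linarith
    · simpa [fareyTree] using p1
  | left v ih =>
    have h := ih.left (lengthTree_mid_pos _) (two_cosh_left v)
    have e : ((fareyTree v).mid.1 : ℝ) = (fareyTree v).fst.1 + (fareyTree v).lst.1 := by
      rw [fareyTree_mid v]; simp [mediant]
    rw [← e] at h
    exact h
  | right v ih =>
    have h := ih.right (lengthTree_mid_pos _) (two_cosh_right v)
    have e : ((fareyTree v).mid.1 : ℝ) = (fareyTree v).fst.1 + (fareyTree v).lst.1 := by
      rw [fareyTree_mid v]; simp [mediant]
    rw [← e] at h
    exact h

/-- For the denominators the roles of the outer entries of a triple are exchanged, since the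
quotient of denominator and length decreases with the Farey fraction. -/
theorem slopeInvariant_den (v : Vertex) :
    SlopeInvariant (fareyTree v).lst.2 (fareyTree v).fst.2
      (lengthTree v).lst (lengthTree v).mid (lengthTree v).fst := by
  induction v with
  | root =>
    obtain ⟨hx, hy, hz⟩ := two_cosh_root
    obtain ⟨p1, p2⟩ := lengthTree_root_pos
    have p3 := lengthTree_mid_pos .root
    refine ⟨by simp [fareyTree], by simp [fareyTree], p2, p3, p1, ?_, ?_, ?_, ?_⟩
    · rw [hx, hy, hz]; norm_num
    · rw [hx, hy, hz]; norm_num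
    · rw [hz, hy]
      have h1 : Real.exp (-(lengthTree .root).fst) < 1 := by
        rw [Real.exp_lt_one_iff]; linarith
      have h2 := Real.exp_pos (-(lengthTree .root).fst)
      have h3 := two_cosh_eq (lengthTree .root).fst
      have h4 := exp_mul_exp_neg (lengthTree .root).fst
      simp only [fareyTree, Nat.cast_one, div_one, one_mul]
      nlinarith
    · simp only [fareyTree, Nat.cast_one, one_mul]
      apply lt_of_two_cosh_lt p2.le
      rw [hx, hz]; norm_num
  | left v ih =>
    have h := ih.right (lengthTree_mid_pos (.left v)) (by rw [two_cosh_left]; ring)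
    have e : ((fareyTree v).mid.2 : ℝ) = (fareyTree v).lst.2 + (fareyTree v).fst.2 := by
      rw [fareyTree_mid v]; simp [mediant, add_comm]
    rw [← e] at h
    exact h
  | right v ih =>
    have h := ih.left (lengthTree_mid_pos (.right v)) (by rw [two_cosh_right]; ring)
    have e : ((fareyTree v).mid.2 : ℝ) = (fareyTree v).lst.2 + (fareyTree v).fst.2 := by
      rw [fareyTree_mid v]; simp [mediant, add_comm]
    rw [← e] at h
    exact h

/-- The quotients of the Farey numerators by the lengths. -/
noncomputable def numDivLength (v : Vertex) : Triple ℝ :=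
  ⟨(fareyTree v).fst.1 / (lengthTree v).fst, (fareyTree v).mid.1 / (lengthTree v).mid,
    (fareyTree v).lst.1 / (lengthTree v).lst⟩

/-- The negatives of the quotients of the Farey denominators by the lengths; the sign makes them
increase with the Farey fraction. -/
noncomputable def negDenDivLength (v : Vertex) : Triple ℝ :=
  ⟨-((fareyTree v).fst.2 / (lengthTree v).fst), -((fareyTree v).mid.2 / (lengthTree v).mid),
    -((fareyTree v).lst.2 / (lengthTree v).lst)⟩

theorem inOrder_numDivLength : InOrder numDivLength where
  left_fst _ := rfl
  left_lst _ := rfl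
  right_fst _ := rfl
  right_lst _ := rfl
  fst_lt v := by
    simpa [numDivLength, fareyTree_mid v, mediant] using (slopeInvariant_num v).weight_div_lt
  mid_lt v := by
    simpa [numDivLength, fareyTree_mid v, mediant] using (slopeInvariant_num v).weight_div_lt'

theorem inOrder_negDenDivLength : InOrder negDenDivLength where
  left_fst _ := rfl
  left_lst _ := rfl
  right_fst _ := rfl
  right_lst _ := rfl
  fst_lt v := by
    simpa [negDenDivLength, fareyTree_mid v, mediant, add_comm] using
      (slopeInvariant_den v).weight_div_lt'
  mid_lt v := by
    simpa [negDenDivLength, fareyTree_mid v, mediant, add_comm] using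
      (slopeInvariant_den v).weight_div_lt

/-- A reduced fraction `p / q` in `(0, 1)` occurs in the Farey tree with numerator `p` and
denominator `q`. -/
theorem exists_fareyTree_mid_eq {p q : ℕ} (hp : 0 < p) (hpq : p < q) (h : Nat.gcd q p = 1) :
    ∃ v, (fareyTree v).mid = (p, q) ∧ fareyMid v = (p : ℚ) / q := by
  have hp' : (0 : ℚ) < p := by exact_mod_cast hp
  have hq' : (0 : ℚ) < q := by exact_mod_cast hp.trans hpq
  obtain ⟨v, hv⟩ := exists_vertex ((p : ℚ) / q) (by positivity)
    (by rw [div_lt_one hq']; exact_mod_cast hpq)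
  refine ⟨v, ?_, hv⟩
  have hd : 0 < (fareyTree v).mid.2 := by
    have := fareyTree_inv v
    rw [fareyTree_mid v]
    simp only [mediant]
    omega
  have := Rat.div_int_inj (a := (fareyTree v).mid.1) (b := (fareyTree v).mid.2) (c := p) (d := q)
    (by exact_mod_cast hd) (by exact_mod_cast hp.trans hpq)
    (by simpa using fareyTree_mid_coprime v) (by simpa using Nat.Coprime.symm h)
    (by simpa [fareyMid] using hv)
  exact Prod.ext (by exact_mod_cast this.1) (by exact_mod_cast this.2)

end MarkovOrder

open MarkovOrder in
theorem theorem1p1 :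
    (∀ p q i : ℕ, 0 < p → 0 < q → 0 < i → p < q → Nat.gcd q p = 1 → Nat.gcd (q + i) p = 1 →
      MarkovOrder.markovNumber ((p : ℚ) / (q : ℚ)) <
        MarkovOrder.markovNumber ((p : ℚ) / ((q : ℚ) + (i : ℚ)))) ∧
    (∀ p q i : ℕ, 0 < p → 0 < q → 0 < i → p + i < q → Nat.gcd q p = 1 → Nat.gcd q (p + i) = 1 →
      MarkovOrder.markovNumber ((p : ℚ) / (q : ℚ)) <
        MarkovOrder.markovNumber (((p : ℚ) + (i : ℚ)) / (q : ℚ))) := by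
  constructor
  · intro p q i hp hq hi hpq h h'
    obtain ⟨v, hv, ev⟩ := exists_fareyTree_mid_eq hp hpq h
    obtain ⟨w, hw, ew⟩ := exists_fareyTree_mid_eq hp (by omega) h'
    have hlt : fareyMid w < fareyMid v := by
      rw [ev, ew]
      have : (0 : ℚ) < p := by exact_mod_cast hp
      have : (0 : ℚ) < q := by exact_mod_cast hq
      gcongr
      omega
    have hg := inOrder_fareyRat.mid_lt_mid inOrder_numDivLength (v := w) (w := v) hlt
    simp only [numDivLength, hv, hw] at hg
    rw [div_lt_div_iff_of_pos_left (by exact_mod_cast hp) (lengthTree_mid_pos w)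
      (lengthTree_mid_pos v)] at hg
    rw [Nat.cast_add] at ew
    rw [← ev, ← ew, markovNumber_fareyMid, markovNumber_fareyMid]
    exact (markovLength_lt_markovLength (markovTree_one_le_mid v) (markovTree_one_le_mid w)).mp hg
  · intro p q i hp hq hi hpq h h'
    obtain ⟨v, hv, ev⟩ := exists_fareyTree_mid_eq hp (by omega) h
    obtain ⟨w, hw, ew⟩ := exists_fareyTree_mid_eq (by omega) hpq h'
    have hlt : fareyMid v < fareyMid w := by
      rw [ev, ew]
      have : (0 : ℚ) < q := by exact_mod_cast hq
      gcongr
      omega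
    have hg := inOrder_fareyRat.mid_lt_mid inOrder_negDenDivLength (v := v) (w := w) hlt
    simp only [negDenDivLength, hv, hw, neg_lt_neg_iff] at hg
    rw [div_lt_div_iff_of_pos_left (by exact_mod_cast hq) (lengthTree_mid_pos w)
      (lengthTree_mid_pos v)] at hg
    rw [Nat.cast_add] at ew
    rw [← ev, ← ew, markovNumber_fareyMid, markovNumber_fareyMid]
    exact (markovLength_lt_markovLength (markovTree_one_le_mid v) (markovTree_one_le_mid w)).mp hg
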